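/- Let $\rho_0$ and $\rho_1$ be probability measures on $\mathbb R^D$ and $\mathbb R^N$, let $\mathcal G$ be a set of maps $\mathbb R^D\to\mathbb R^N$, and let ${\rm div}$ be a $[0,\infty]$-valued divergence on probability measures on $\mathbb R^N$ with ${\rm div}(p\|q)=0\iff p=q$. Let $J_t(x_0,x_1)$, $t\in[0,1]$, $x_0,x_1\in\mathbb R^N$, be an interpolant: $J_0(x_0,x_1)=x_0$, $J_1(x_0,x_1)=x_1$, continuous in $t\in[0,1]$, differentiable in $t\in(0,1)$, and measurable in $(x_0,x_1)$. For a probability measure $\rho$ on $\mathbb R^N\times\mathbb R^N$ such that $\partial_tJ_t(x_0,x_1)$ is integrable for $t\sim U(0,1)$, $(x_0,x_1)\sim\rho$ independent, let $$v^{(\rho,J)}_t(x)=\mathbb E_{(x_0,x_1)\sim\rho}\big[\partial_tJ_t(x_0,x_1)\,\big|\,J_t(x_0,x_1)=x\big].$$ A consistency model is a family $f_t:\mathbb R^N\to\mathbb R^N$, $t\in[0,1]$, that is $C^1$ in $(t,x)$ and satisfies $f_1={\rm Id}$. Its generalized consistency loss is taken in the limit $\Delta t\to0$ (with the normalization $\Delta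 t^{-2}$, without which the limit would always be $0$): $$\mathcal L_{\rm GCM}(f,v^{(\rho,J)})=\mathbb E_{t\sim U(0,1),\,(x_0,x_1)\sim\rho,\,\tilde x_t=J_t(x_0,x_1)}\ \lim_{\Delta t\downarrow0}\frac{\big\|f_t(\tilde x_t)-f_{t+\Delta t}\big(\tilde x_t+v^{(\rho,J)}_t(\tilde x_t)\Delta t\big)\big\|_2^2}{\Delta t^2}.$$ Let $\mathcal C$ be any set of admissible couplings $\rho$ (for instance all of them, all product couplings, all optimal transport couplings, or a single one). The three-network problem is $$\min_{g,h,f_t,\rho}\ \mathcal L_{\rm GCM}(f_t,v^{(\rho,J)})\quad\text{s.t.}\quad g=f_0\circ h\in\mathcal G,\quad \rho\in\mathcal C\cap\Pi(h_\#\rho_0,\rho_1),$$ where $h:\mathbb R^D\to\mathbb R^N$ is $\rho_0$-measurable, $f_t$ is a consistency model, $\Pi(\mu,\nu)$ is the set of joint distributions with marginals $\mu$ and $\nu$, and $\rho$ is such that $v^{(\rho,J)}$ is defined. Assume that for at least one $\rho\in\mathcal C$ with second marginal $\rho_1$ the field $v^{(\rho,J)}$ is defined and (some version of it) generates a flow: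 there are bijections $\psi_t$ of $\mathbb R^N$, $t\in[0,1]$, with $\psi_t(x)$ and $\psi_t^{-1}(x)$ both $C^1$ in $(t,x)$, $\psi_0={\rm Id}$, and $\frac{d}{dt}\psi_t(x)=v^{(\rho,J)}_t(\psi_t(x))$ for all $x$ and all $t\in(0,1)$. (If all couplings are admissible and $J_t(x_0,x_1)=(1-t)x_0+tx_1$, this always holds.) Suppose that there is a measurable $g^\star\in\mathcal G$ with ${\rm div}([g^\star]_\#\rho_0\|\rho_1)=0$, and let $(\hat g,\hat h,\hat f_t)$ be a solution of the three-network problem (that is, together with some coupling $\hat\rho$ it is feasible and attains the minimum). Then $\hat g=\hat f_0\circ\hat h$ solves the constrained distribution-matching problem $$\min_{g\in\mathcal G}\ {\rm div}([g]_\#\rho_0\|\rho_1),$$ that is, $\hat g\in\mathcal G$ attains this minimum, and moreover $[\hat g]_\#\rho_0=\rho_1$. -/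

import Mathlib

open MeasureTheory Set Filter Topology
open scoped ENNReal

noncomputable section

namespace FlowMatching

/-- `ℝ^n` with its Euclidean norm. -/
abbrev E (n : ℕ) : Type := EuclideanSpace ℝ (Fin n)

/-- A (stochastic) interpolant `J_t(x₀, x₁)`, `t ∈ [0,1]`: it joins `x₀` to `x₁`, is continuous on
`[0,1]` and differentiable on `(0,1)` in time, and is measurable in the end points. -/
structure IsInterpolant {n : ℕ} (J : ℝ → E n → E n → E n) : Prop where
  zero : ∀ x₀ x₁, J 0 x₀ x₁ = x₀
  one : ∀ x₀ x₁, J 1 x₀ x₁ = x₁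
  continuousOn : ∀ x₀ x₁, ContinuousOn (fun t => J t x₀ x₁) (Icc 0 1)
  differentiableOn : ∀ x₀ x₁, DifferentiableOn ℝ (fun t => J t x₀ x₁) (Ioo 0 1)
  measurable : ∀ t ∈ Icc (0 : ℝ) 1, Measurable (fun p : E n × E n => J t p.1 p.2)

/-- `ρ ∈ Π(μ, ν)`: the joint distribution `ρ` has marginals `μ` and `ν`. -/
def IsCoupling {n : ℕ} (ρ : Measure (E n × E n)) (μ ν : Measure (E n)) : Prop :=
  ρ.fst = μ ∧ ρ.snd = ν

/-- `v` is (a version of) the vector field `v^{(ρ,J)}`,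
`v_t(x) = 𝔼_{(x₀,x₁) ∼ ρ} [∂_t J_t(x₀,x₁) | J_t(x₀,x₁) = x]`.
The time derivative has to be integrable for the conditional expectation to make sense. For each
`t` the field is determined up to null sets of the law of `J_t(x₀,x₁)`. -/
structure IsVelocityField {n : ℕ} (J : ℝ → E n → E n → E n) (ρ : Measure (E n × E n))
    (v : ℝ → E n → E n) : Prop where
  measurable : Measurable (Function.uncurry v)
  integrable : Integrable
    (fun q : ℝ × (E n × E n) => deriv (fun s => J s q.2.1 q.2.2) q.1)
    ((volume.restrict (Ioo (0 : ℝ) 1)).prod ρ)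
  condExp_eq : ∀ᵐ t ∂(volume.restrict (Ioo (0 : ℝ) 1)),
    (fun p : E n × E n => v t (J t p.1 p.2)) =ᵐ[ρ]
      ρ[fun p : E n × E n => deriv (fun s => J s p.1 p.2) t |
        MeasurableSpace.comap (fun p : E n × E n => J t p.1 p.2) inferInstance]

/-- `ψ` is a continuously differentiable flow on `[0,1]` generated by the vector field `v`:
`ψ_0 = Id`, `d/dt ψ_t(x) = v_t(ψ_t(x))`, and every `ψ_t` is invertible with an inverse that is
continuously differentiable in `(t, x)`. -/
structure IsFlow {n : ℕ} (v : ℝ → E n → E n) (ψ : ℝ → E n → E n) : Prop where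
  zero : ∀ x, ψ 0 x = x
  contDiffOn : ContDiffOn ℝ 1 (Function.uncurry ψ) (Icc (0 : ℝ) 1 ×ˢ univ)
  hasDerivAt : ∀ x, ∀ t ∈ Ioo (0 : ℝ) 1, HasDerivAt (fun s => ψ s x) (v t (ψ t x)) t
  inverse : ∃ χ : ℝ → E n → E n,
    ContDiffOn ℝ 1 (Function.uncurry χ) (Icc (0 : ℝ) 1 ×ˢ univ) ∧
    ∀ t ∈ Icc (0 : ℝ) 1, Function.LeftInverse (χ t) (ψ t) ∧ Function.RightInverse (χ t) (ψ t)

/-- The consistency models `f_t`, `t ∈ [0,1]`, over which the loss is minimized: continuously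
differentiable in `(t, x)` and with the boundary condition `f_1 = Id` of consistency models. -/
structure IsConsistencyModel {n : ℕ} (f : ℝ → E n → E n) : Prop where
  contDiffOn : ContDiffOn ℝ 1 (Function.uncurry f) (Icc (0 : ℝ) 1 ×ˢ univ)
  one : ∀ x, f 1 x = x

/-- The consistency error for the step `δ = Δt`:
`‖f_t(x) - f_{t+δ}(x + v_t(x) δ)‖²`. -/
def consistencyError {n : ℕ} (f v : ℝ → E n → E n) (t : ℝ) (x : E n) (δ : ℝ) : ℝ≥0∞ :=
  ‖f t x - f (t + δ) (x + δ • v t x)‖ₑ ^ 2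

/-- The generalized consistency loss for `Δt → 0`,
`𝔼_{t ∼ U(0,1), (x₀,x₁) ∼ ρ, x = J_t(x₀,x₁)} lim_{δ → 0+} ‖f_t(x) - f_{t+δ}(x + v_t(x) δ)‖² / δ²`.
(Without the factor `1 / δ²` the limit would vanish for every `f`. For a continuously
differentiable `f` the limit exists.) -/
def lossGCM {n : ℕ} (J : ℝ → E n → E n → E n) (ρ : Measure (E n × E n))
    (f v : ℝ → E n → E n) : ℝ≥0∞ :=
  ∫⁻ t in Ioo (0 : ℝ) 1, ∫⁻ p : E n × E n,
    liminf (fun δ : ℝ => consistencyError f v t (J t p.1 p.2) δ / ENNReal.ofReal (δ ^ 2)) (𝓝[>] 0)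
      ∂ρ

/-- The constraints of the three-network problem:
`g = f_0 ∘ h ∈ 𝒢`, and `ρ ∈ Π(h_# ρ₀, ρ₁)` is a coupling from the class `𝒞` of admissible couplings,
with `v = v^{(ρ,J)}`. -/
structure IsFeasible {d n : ℕ} (ρ₀ : Measure (E d)) (ρ₁ : Measure (E n))
    (J : ℝ → E n → E n → E n) (𝒞 : Set (Measure (E n × E n))) (𝒢 : Set (E d → E n))
    (g h : E d → E n) (f : ℝ → E n → E n) (ρ : Measure (E n × E n)) (v : ℝ → E n → E n) :
    Prop where
  aemeasurable : AEMeasurable h ρ₀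
  model : IsConsistencyModel f
  mem : f 0 ∘ h ∈ 𝒢
  eq_comp : g = f 0 ∘ h
  admissible : ρ ∈ 𝒞
  coupling : IsCoupling ρ (ρ₀.map h) ρ₁
  velocity : IsVelocityField J ρ v

/-- `(g, h, f)` solves the three-network problem: with some coupling it is feasible and attains the
least loss among all feasible choices. -/
def IsGCMSolution {d n : ℕ} (ρ₀ : Measure (E d)) (ρ₁ : Measure (E n))
    (J : ℝ → E n → E n → E n) (𝒞 : Set (Measure (E n × E n))) (𝒢 : Set (E d → E n))
    (g h : E d → E n) (f : ℝ → E n → E n) : Prop :=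
  ∃ ρ v, IsFeasible ρ₀ ρ₁ J 𝒞 𝒢 g h f ρ v ∧
    ∀ g' h' f' ρ' v', IsFeasible ρ₀ ρ₁ J 𝒞 𝒢 g' h' f' ρ' v' →
      lossGCM J ρ f v ≤ lossGCM J ρ' f' v'

/-- A distribution divergence: it vanishes exactly on pairs of equal distributions. -/
def IsDivergence {n : ℕ} (div : Measure (E n) → Measure (E n) → ℝ≥0∞) : Prop :=
  ∀ p q : Measure (E n), IsProbabilityMeasure p → IsProbabilityMeasure q → (div p q = 0 ↔ p = q)

/-- `g` solves the constrained distribution-matching problem: it minimizes `div(g_# ρ₀ ‖ ρ₁)` over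
the class `𝒢`. -/
def IsMatchingSolution {d n : ℕ} (div : Measure (E n) → Measure (E n) → ℝ≥0∞)
    (ρ₀ : Measure (E d)) (ρ₁ : Measure (E n)) (𝒢 : Set (E d → E n)) (g : E d → E n) : Prop :=
  g ∈ 𝒢 ∧ AEMeasurable g ρ₀ ∧
    ∀ g' ∈ 𝒢, AEMeasurable g' ρ₀ → div (ρ₀.map g) ρ₁ ≤ div (ρ₀.map g') ρ₁

end FlowMatching

end

open FlowMatching

/-! The limiting loss is the mean square of the material derivative `∂_t f + Df · v` along the
interpolant, so zero loss means that `f` is constant along `v` there. Two facts carry the proof.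

Zero loss forces matching (`IsConsistencyModel.map_fst_eq_snd`). For bounded `C¹` functions `φ`, the
material derivative of `W = φ ∘ f` vanishes too. As `v_t(J_t)` is the conditional mean of `∂_t J_t`,
formally `d/dt 𝔼 W(t, J_t) = 0`, whence `𝔼 φ(f_0(x₀)) = 𝔼 φ(f_1(x₁)) = 𝔼 φ(x₁)`. Since `Df` may be
unbounded, a cut-off in space is inserted and then removed, using integrability of `∂_t J`. The
model itself supplies the test functions, so no uniqueness theorem for the continuity equation is
needed.

Zero loss is attained (`IsFlow.exists_isConsistencyModel`). Take `f_t = ψ_1 ∘ ψ_t⁻¹` and `h = f_0⁻¹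
∘ g⋆`; the first fact, applied to this `f`, shows that the coupling that generates the flow has
first marginal `h_# ρ₀`. Hence every solution has zero loss, and the first fact applies to it. -/

namespace FlowMatching

/-! ### Calculus and measurability on the time-space cylinder -/

/-- The time-space cylinder `[0,1] × ℝ^n`. -/
abbrev cylinder (n : ℕ) : Set (ℝ × E n) := Icc (0 : ℝ) 1 ×ˢ univ

lemma uniqueDiffOn_cylinder (n : ℕ) : UniqueDiffOn ℝ (cylinder n) :=
  (uniqueDiffOn_Icc zero_lt_one).prod uniqueDiffOn_univ

lemma mem_cylinder {n : ℕ} {t : ℝ} (ht : t ∈ Icc (0 : ℝ) 1) (x : E n) : (t, x) ∈ cylinder n :=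
  ⟨ht, mem_univ x⟩

lemma cylinder_mem_nhds {n : ℕ} {t : ℝ} (ht : t ∈ Ioo (0 : ℝ) 1) (x : E n) :
    cylinder n ∈ 𝓝 (t, x) :=
  prod_mem_nhds (Icc_mem_nhds ht.1 ht.2) univ_mem

lemma hasFDerivAt_of_contDiffOn_cylinder {n : ℕ} {F : Type*} [NormedAddCommGroup F]
    [NormedSpace ℝ F] {W : ℝ × E n → F} (hW : ContDiffOn ℝ 1 W (cylinder n)) {t : ℝ}
    (ht : t ∈ Ioo (0 : ℝ) 1) (x : E n) :
    HasFDerivAt W (fderivWithin ℝ W (cylinder n) (t, x)) (t, x) :=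
  (((hW.differentiableOn one_ne_zero) _ (mem_cylinder (Ioo_subset_Icc_self ht) x)).hasFDerivWithinAt
    ).hasFDerivAt (cylinder_mem_nhds ht x)

lemma continuousOn_fderivWithin_cylinder {n : ℕ} {F : Type*} [NormedAddCommGroup F]
    [NormedSpace ℝ F] {W : ℝ × E n → F} (hW : ContDiffOn ℝ 1 W (cylinder n)) :
    ContinuousOn (fderivWithin ℝ W (cylinder n)) (cylinder n) :=
  hW.continuousOn_fderivWithin (uniqueDiffOn_cylinder n) le_rfl

/-- Clamping of a time to `[0,1]`. -/
noncomputable def clamp (t : ℝ) : ℝ := projIcc (0 : ℝ) 1 zero_le_one t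

lemma continuous_clamp : Continuous clamp := continuous_subtype_val.comp continuous_projIcc

lemma clamp_mem (t : ℝ) : clamp t ∈ Icc (0 : ℝ) 1 := (projIcc (0 : ℝ) 1 zero_le_one t).2

lemma clamp_of_mem {t : ℝ} (ht : t ∈ Icc (0 : ℝ) 1) : clamp t = t := by
  simp [clamp, projIcc_of_mem zero_le_one ht]

/-- Measurability in the end points and continuity in time give joint measurability; clamping makes
the time continuity global. -/
lemma IsInterpolant.measurable_clamp {n : ℕ} {J : ℝ → E n → E n → E n} (hJ : IsInterpolant J) :
    Measurable (fun q : ℝ × (E n × E n) => J (clamp q.1) q.2.1 q.2.2) := by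
  refine measurable_uncurry_of_continuous_of_measurable
    (u := fun (t : ℝ) (p : E n × E n) => J (clamp t) p.1 p.2) (fun p => ?_) fun t => ?_
  · exact (hJ.continuousOn p.1 p.2).comp_continuous continuous_clamp clamp_mem
  · exact hJ.measurable _ (clamp_mem t)

lemma IsInterpolant.stronglyMeasurable_comp_clamp {n : ℕ} {J : ℝ → E n → E n → E n}
    (hJ : IsInterpolant J) {F : Type*} [TopologicalSpace F] {D : ℝ × E n → F}
    (hD : ContinuousOn D (cylinder n)) :
    StronglyMeasurable
      (fun q : ℝ × (E n × E n) => D (clamp q.1, J (clamp q.1) q.2.1 q.2.2)) := by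
  have h1 : Continuous fun z : ℝ × E n => D (clamp z.1, z.2) :=
    hD.comp_continuous ((continuous_clamp.comp continuous_fst).prodMk continuous_snd)
      fun z => mem_cylinder (clamp_mem _) _
  exact h1.comp_stronglyMeasurable
    (measurable_fst.prodMk hJ.measurable_clamp).stronglyMeasurable

lemma ae_mem_Ioo_prod {α : Type*} [MeasurableSpace α] (ρ : Measure α) [SFinite ρ] :
    ∀ᵐ q ∂((volume.restrict (Ioo (0 : ℝ) 1)).prod ρ), q.1 ∈ Ioo (0 : ℝ) 1 :=
  Measure.quasiMeasurePreserving_fst.ae (ae_restrict_mem measurableSet_Ioo)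

lemma IsInterpolant.aestronglyMeasurable_comp {n : ℕ} {J : ℝ → E n → E n → E n}
    (hJ : IsInterpolant J) {F : Type*} [TopologicalSpace F] {D : ℝ × E n → F}
    (hD : ContinuousOn D (cylinder n)) (ρ : Measure (E n × E n)) [SFinite ρ] :
    AEStronglyMeasurable (fun q : ℝ × (E n × E n) => D (q.1, J q.1 q.2.1 q.2.2))
      ((volume.restrict (Ioo (0 : ℝ) 1)).prod ρ) := by
  refine ⟨_, hJ.stronglyMeasurable_comp_clamp hD, ?_⟩
  filter_upwards [ae_mem_Ioo_prod ρ] with q hq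
  rw [clamp_of_mem (Ioo_subset_Icc_self hq)]

lemma IsInterpolant.hasDerivAt {n : ℕ} {J : ℝ → E n → E n → E n} (hJ : IsInterpolant J)
    (p : E n × E n) {t : ℝ} (ht : t ∈ Ioo (0 : ℝ) 1) :
    HasDerivAt (fun s => J s p.1 p.2) (deriv (fun s => J s p.1 p.2) t) t :=
  ((hJ.differentiableOn p.1 p.2).differentiableAt (isOpen_Ioo.mem_nhds ht)).hasDerivAt

/-! ### Conservation of means along the interpolant -/

/-- Testing against a bounded function of the conditioning variable does not distinguish a random
vector from its conditional expectation. -/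
lemma integral_bilin_condExp {Ω F G H : Type*} {m mΩ : MeasurableSpace Ω} {μ : Measure Ω}
    [IsFiniteMeasure μ] [NormedAddCommGroup F] [NormedSpace ℝ F] [NormedAddCommGroup G]
    [NormedSpace ℝ G] [CompleteSpace G] [NormedAddCommGroup H] [NormedSpace ℝ H] [CompleteSpace H]
    (B : F →L[ℝ] G →L[ℝ] H) (hm : m ≤ mΩ) {a : Ω → F} {g u : Ω → G}
    (ha : StronglyMeasurable[m] a) (hg : Integrable g μ) (C : ℝ) (hC : ∀ ω, ‖a ω‖ ≤ C)
    (hu : u =ᵐ[μ] μ[g | m]) :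
    ∫ ω, B (a ω) (g ω) ∂μ = ∫ ω, B (a ω) (u ω) ∂μ := by
  rw [← integral_condExp hm]
  refine integral_congr_ae ?_
  filter_upwards [condExp_stronglyMeasurable_bilin_of_bound B hm ha hg C (ae_of_all _ hC), hu]
    with ω h1 h2
  rw [h1, h2]

/-- A continuous function on the cylinder is bounded after multiplication by a compactly supported
function of space. -/
lemma exists_bound_smul_of_hasCompactSupport {n : ℕ} {F : Type*} [NormedAddCommGroup F]
    [NormedSpace ℝ F] {θ : E n → ℝ} (hθ : Continuous θ) (hsupp : HasCompactSupport θ)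
    {D : ℝ × E n → F} (hD : ContinuousOn D (cylinder n)) :
    ∃ C, ∀ t ∈ Icc (0 : ℝ) 1, ∀ x, ‖θ x • D (t, x)‖ ≤ C := by
  have hc : ContinuousOn (fun z : ℝ × E n => θ z.2 • D z) (Icc (0 : ℝ) 1 ×ˢ tsupport θ) :=
    (hθ.comp continuous_snd).continuousOn.smul (hD.mono (prod_mono_right (subset_univ _)))
  obtain ⟨C, hC⟩ := (isCompact_Icc.prod hsupp.isCompact).exists_bound_of_continuousOn hc
  refine ⟨max C 0, fun t ht x => ?_⟩
  by_cases hx : x ∈ tsupport θ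
  · exact (hC (t, x) ⟨ht, hx⟩).trans (le_max_left _ _)
  · simp [image_eq_zero_of_notMem_tsupport hx]

section Transport

variable {n : ℕ} {J : ℝ → E n → E n → E n} {ρ : Measure (E n × E n)} [IsProbabilityMeasure ρ]
  {v : ℝ → E n → E n} {W : ℝ × E n → ℂ}

/-- The conditional expectation may be replaced by `∂_t J` when tested against a function of
`J_t`, so the localized material derivative of `W` integrates to zero. -/
lemma integral_smul_material_derivative_eq_zero (hJ : IsInterpolant J)
    (hv : IsVelocityField J ρ v) (hW : ContDiffOn ℝ 1 W (cylinder n))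
    (htr : ∀ᵐ t ∂(volume.restrict (Ioo (0 : ℝ) 1)), ∀ᵐ p ∂ρ,
      fderivWithin ℝ W (cylinder n) (t, J t p.1 p.2) (1, v t (J t p.1 p.2)) = 0)
    {θ : E n → ℝ} (hθ : Continuous θ) (hsupp : HasCompactSupport θ) :
    Integrable (fun q : ℝ × (E n × E n) => θ (J q.1 q.2.1 q.2.2) •
        fderivWithin ℝ W (cylinder n) (q.1, J q.1 q.2.1 q.2.2)
          (1, deriv (fun s => J s q.2.1 q.2.2) q.1)) ((volume.restrict (Ioo (0 : ℝ) 1)).prod ρ) ∧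
      ∫ q, θ (J q.1 q.2.1 q.2.2) • fderivWithin ℝ W (cylinder n) (q.1, J q.1 q.2.1 q.2.2)
          (1, deriv (fun s => J s q.2.1 q.2.2) q.1)
        ∂((volume.restrict (Ioo (0 : ℝ) 1)).prod ρ) = 0 := by
  have hDc := continuousOn_fderivWithin_cylinder hW
  set A : ℝ × E n → (ℝ × E n →L[ℝ] ℂ) := fun z => θ z.2 • fderivWithin ℝ W (cylinder n) z with hA
  have hAc : ContinuousOn A (cylinder n) := (hθ.comp continuous_snd).continuousOn.smul hDc
  obtain ⟨C, hC⟩ := exists_bound_smul_of_hasCompactSupport hθ hsupp hDc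
  have hint : Integrable (fun q : ℝ × (E n × E n) => A (q.1, J q.1 q.2.1 q.2.2)
      (1, deriv (fun s => J s q.2.1 q.2.2) q.1)) ((volume.restrict (Ioo (0 : ℝ) 1)).prod ρ) := by
    refine (ContinuousLinearMap.id ℝ (ℝ × E n →L[ℝ] ℂ)).integrable_of_bilin_of_bdd_left C
      (hJ.aestronglyMeasurable_comp hAc ρ) ?_ ((integrable_const (1 : ℝ)).prodMk hv.integrable)
    filter_upwards [ae_mem_Ioo_prod ρ] with q hq using hC _ (Ioo_subset_Icc_self hq) _
  refine ⟨hint, ?_⟩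
  change ∫ q, A (q.1, J q.1 q.2.1 q.2.2) (1, deriv (fun s => J s q.2.1 q.2.2) q.1)
    ∂((volume.restrict (Ioo (0 : ℝ) 1)).prod ρ) = 0
  rw [integral_prod _ hint]
  refine integral_eq_zero_of_ae ?_
  filter_upwards [hv.integrable.prod_right_ae, hv.condExp_eq, htr,
    ae_restrict_mem measurableSet_Ioo] with t hg hu h0 ht
  have htI := Ioo_subset_Icc_self ht
  have hAt : Continuous fun x => A (t, x) :=
    hAc.comp_continuous (by fun_prop) fun x => mem_cylinder htI x
  have hcomap := comap_measurable (m := inferInstanceAs (MeasurableSpace (E n))) (fun p : E n × E n => J t p.1 p.2)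
  have hle := (hJ.measurable t htI).comap_le
  have ha : StronglyMeasurable[MeasurableSpace.comap (fun p : E n × E n => J t p.1 p.2)
      inferInstance] fun p : E n × E n => A (t, J t p.1 p.2) :=
    hAt.comp_stronglyMeasurable hcomap.stronglyMeasurable
  have hui : Integrable (fun p : E n × E n => v t (J t p.1 p.2)) ρ :=
    integrable_condExp.congr hu.symm
  -- `B L w = L (0, w)`: only this spatial part of `L (1, w)` involves the velocity, and it is
  -- linear in `w`, as the conditional expectation requires.
  let B : (ℝ × E n →L[ℝ] ℂ) →L[ℝ] E n →L[ℝ] ℂ :=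
    (ContinuousLinearMap.compL ℝ (E n) (ℝ × E n) ℂ).flip (ContinuousLinearMap.inr ℝ ℝ (E n))
  have hB : ∀ (L : ℝ × E n →L[ℝ] ℂ) w, L (1, w) = L (1, 0) + B L w := fun L w => by
    simp [B, ← map_add]
  have hbd : ∀ p : E n × E n, ‖A (t, J t p.1 p.2)‖ ≤ C := fun p => hC t htI _
  have hs := (ha.mono hle).aestronglyMeasurable (μ := ρ)
  have hi0 : Integrable (fun p : E n × E n => A (t, J t p.1 p.2) (1, 0)) ρ :=
    (ContinuousLinearMap.id ℝ (ℝ × E n →L[ℝ] ℂ)).integrable_of_bilin_of_bdd_left C hs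
      (ae_of_all _ hbd) (integrable_const ((1 : ℝ), (0 : E n)))
  have hi1 := B.integrable_of_bilin_of_bdd_left C hs (ae_of_all _ hbd) hg
  have hi2 := B.integrable_of_bilin_of_bdd_left C hs (ae_of_all _ hbd) hui
  calc ∫ p, A (t, J t p.1 p.2) (1, deriv (fun s => J s p.1 p.2) t) ∂ρ
      = ∫ p, A (t, J t p.1 p.2) (1, v t (J t p.1 p.2)) ∂ρ := by
        simp_rw [hB _ (deriv _ _), hB _ (v _ _)]
        rw [integral_add hi0 hi1, integral_add hi0 hi2,
          integral_bilin_condExp B hle ha hg C hbd hu]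
    _ = 0 := by
        refine integral_eq_zero_of_ae ?_
        filter_upwards [h0] with p hp
        simp [hA, hp]

/-- Up to the flux through the cut-off region, the mean of `W` along the interpolant is
conserved. -/
lemma norm_integral_cutoff_sub_le (hJ : IsInterpolant J)
    (hv : IsVelocityField J ρ v) (hW : ContDiffOn ℝ 1 W (cylinder n)) {M : ℝ}
    (hM : ∀ z, ‖W z‖ ≤ M)
    (htr : ∀ᵐ t ∂(volume.restrict (Ioo (0 : ℝ) 1)), ∀ᵐ p ∂ρ,
      fderivWithin ℝ W (cylinder n) (t, J t p.1 p.2) (1, v t (J t p.1 p.2)) = 0)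
    {θ : E n → ℝ} (hθ : ContDiff ℝ 1 θ) (hsupp : HasCompactSupport θ) {c : ℝ}
    (hc : ∀ x, ‖fderiv ℝ θ x‖ ≤ c) :
    ‖∫ p, (θ p.2 • W (1, p.2) - θ p.1 • W (0, p.1)) ∂ρ‖ ≤
      c * M * ∫ q, ‖deriv (fun s => J s q.2.1 q.2.2) q.1‖
        ∂((volume.restrict (Ioo (0 : ℝ) 1)).prod ρ) := by
  obtain ⟨hi, h0⟩ := integral_smul_material_derivative_eq_zero hJ hv hW htr hθ.continuous hsupp
  set ν := (volume.restrict (Ioo (0 : ℝ) 1)).prod ρ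
  -- The flux term, where the derivative falls on the cut-off: the only part of `d/dt (θ W)(J_t)`
  -- that survives averaging.
  have hfl_bd : ∀ q : ℝ × (E n × E n), ‖fderiv ℝ θ (J q.1 q.2.1 q.2.2)
      (deriv (fun s => J s q.2.1 q.2.2) q.1) • W (q.1, J q.1 q.2.1 q.2.2)‖ ≤
      c * M * ‖deriv (fun s => J s q.2.1 q.2.2) q.1‖ := fun q => by
    rw [norm_smul]
    have h1 := (fderiv ℝ θ (J q.1 q.2.1 q.2.2)).le_of_opNorm_le (hc _)
      (deriv (fun s => J s q.2.1 q.2.2) q.1)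
    calc _ ≤ (c * ‖deriv (fun s => J s q.2.1 q.2.2) q.1‖) * M :=
          mul_le_mul h1 (hM _) (norm_nonneg _) ((norm_nonneg _).trans h1)
      _ = _ := by ring
  have hdθ : Continuous (fderiv ℝ θ) := hθ.continuous_fderiv one_ne_zero
  have hfl_int : Integrable (fun q : ℝ × (E n × E n) => fderiv ℝ θ (J q.1 q.2.1 q.2.2)
      (deriv (fun s => J s q.2.1 q.2.2) q.1) • W (q.1, J q.1 q.2.1 q.2.2)) ν := by
    refine (hv.integrable.norm.const_mul (c * M)).mono' ?_ (ae_of_all _ hfl_bd)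
    refine AEStronglyMeasurable.smul (𝕜 := ℝ) ?_ (hJ.aestronglyMeasurable_comp hW.continuousOn ρ)
    exact isBoundedBilinearMap_apply.continuous.comp_aestronglyMeasurable
      ((hJ.aestronglyMeasurable_comp (D := fun z => fderiv ℝ θ z.2)
        (hdθ.comp continuous_snd).continuousOn ρ).prodMk hv.integrable.aestronglyMeasurable)
  have hsum := hi.add hfl_int
  have hftc : ∀ᵐ p ∂ρ, θ p.2 • W (1, p.2) - θ p.1 • W (0, p.1) =
      ∫ t in Ioo (0 : ℝ) 1, (θ (J t p.1 p.2) • fderivWithin ℝ W (cylinder n) (t, J t p.1 p.2)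
          (1, deriv (fun s => J s p.1 p.2) t) +
        fderiv ℝ θ (J t p.1 p.2) (deriv (fun s => J s p.1 p.2) t) • W (t, J t p.1 p.2)) := by
    -- Fubini gives integrability in time for almost every pair of end points, so the fundamental
    -- theorem of calculus needs the derivative only on the open interval.
    filter_upwards [hsum.prod_left_ae] with p hp
    have hcont : ContinuousOn (fun t => θ (J t p.1 p.2) • W (t, J t p.1 p.2)) (Icc 0 1) := by
      have hJc := hJ.continuousOn p.1 p.2
      exact (hθ.continuous.comp_continuousOn hJc).smul
        (hW.continuousOn.comp (continuousOn_id.prodMk hJc) fun t ht => mem_cylinder ht _)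
    have hder : ∀ t ∈ Ioo (0 : ℝ) 1,
        HasDerivAt (fun t => θ (J t p.1 p.2) • W (t, J t p.1 p.2))
          (θ (J t p.1 p.2) • fderivWithin ℝ W (cylinder n) (t, J t p.1 p.2)
            (1, deriv (fun s => J s p.1 p.2) t) +
          fderiv ℝ θ (J t p.1 p.2) (deriv (fun s => J s p.1 p.2) t) • W (t, J t p.1 p.2)) t := by
      intro t ht
      have hJd := hJ.hasDerivAt p ht
      have h1 := ((hθ.differentiable one_ne_zero) (J t p.1 p.2)).hasFDerivAt.comp_hasDerivAt t hJd
      have h2 := (hasFDerivAt_of_contDiffOn_cylinder hW ht (J t p.1 p.2)).comp_hasDerivAt t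
        ((hasDerivAt_id t).prodMk hJd)
      exact h1.smul h2
    have := intervalIntegral.integral_eq_sub_of_hasDerivAt_of_le zero_le_one hcont hder
      ((intervalIntegrable_iff_integrableOn_Ioo_of_le zero_le_one).2 hp)
    rw [intervalIntegral.integral_of_le zero_le_one, integral_Ioc_eq_integral_Ioo] at this
    simpa [hJ.zero, hJ.one] using this.symm
  rw [integral_congr_ae hftc]
  have hfub := integral_prod_symm _ hsum
  simp only [Pi.add_apply] at hfub
  rw [← hfub, integral_add hi hfl_int, h0, zero_add, ← integral_const_mul]
  exact norm_integral_le_of_norm_le (hv.integrable.norm.const_mul _) (ae_of_all _ hfl_bd)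

/-- A bounded `C¹` function that is constant along the velocity field has the same mean at both
ends of the interpolant. -/
lemma integral_end_eq_integral_start (hJ : IsInterpolant J)
    (hv : IsVelocityField J ρ v) (hW : ContDiffOn ℝ 1 W (cylinder n)) {M : ℝ}
    (hM : ∀ z, ‖W z‖ ≤ M)
    (htr : ∀ᵐ t ∂(volume.restrict (Ioo (0 : ℝ) 1)), ∀ᵐ p ∂ρ,
      fderivWithin ℝ W (cylinder n) (t, J t p.1 p.2) (1, v t (J t p.1 p.2)) = 0) :
    ∫ p, W (1, p.2) ∂ρ = ∫ p, W (0, p.1) ∂ρ := by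
  -- The rescaled bumps `b (x / (k + 1))` tend to `1` pointwise, while their gradients are at most
  -- `c / (k + 1)`, so the flux vanishes in the limit.
  let b : ContDiffBump (0 : E n) := ⟨1, 2, one_pos, one_lt_two⟩
  have hb : ContDiff ℝ 1 b := b.contDiff
  obtain ⟨c, hc⟩ := (hb.continuous_fderiv one_ne_zero).bounded_above_of_compact_support
    (b.hasCompactSupport.fderiv ℝ)
  let r : ℕ → ℝ := fun k => 1 / ((k : ℝ) + 1)
  have hr : ∀ k, 0 < r k := fun k => by positivity
  have hr0 : Tendsto r atTop (𝓝 0) := tendsto_one_div_add_atTop_nhds_zero_nat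
  let θ : ℕ → E n → ℝ := fun k x => b (r k • x)
  have hθ : ∀ k, ContDiff ℝ 1 (θ k) := fun k => hb.comp (contDiff_const_smul (r k))
  have hθs : ∀ k, HasCompactSupport (θ k) := fun k => b.hasCompactSupport.comp_smul (hr k).ne'
  have hθd : ∀ k x, ‖fderiv ℝ (θ k) x‖ ≤ r k * c := fun k x => by
    have h1 : fderiv ℝ (θ k) x = r k • fderiv ℝ b (r k • x) := fderiv_comp_smul ..
    rw [h1, norm_smul, Real.norm_of_nonneg (hr k).le]
    exact mul_le_mul_of_nonneg_left (hc _) (hr k).le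
  have hW1 : Continuous fun p : E n × E n => W (1, p.2) :=
    hW.continuousOn.comp_continuous (by fun_prop) fun p => mem_cylinder (by simp) _
  have hW0 : Continuous fun p : E n × E n => W (0, p.1) :=
    hW.continuousOn.comp_continuous (by fun_prop) fun p => mem_cylinder (by simp) _
  have hθ1 : ∀ x, Tendsto (fun k => θ k x) atTop (𝓝 1) := fun x => by
    have h1 : Tendsto (fun k => r k • x) atTop (𝓝 0) := by simpa using hr0.smul_const x
    have h2 : b (0 : E n) = 1 := b.one_of_mem_closedBall (by simp [b])
    rw [← h2]
    exact (hb.continuous.tendsto 0).comp h1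
  have hθ_le : ∀ k x (w : ℂ), ‖w‖ ≤ M → ‖θ k x • w‖ ≤ M := fun k x w hw => by
    rw [norm_smul, Real.norm_of_nonneg b.nonneg]
    exact (mul_le_of_le_one_left (norm_nonneg _) b.le_one).trans hw
  have hlim : Tendsto (fun k => ∫ p, (θ k p.2 • W (1, p.2) - θ k p.1 • W (0, p.1)) ∂ρ) atTop
      (𝓝 (∫ p, (W (1, p.2) - W (0, p.1)) ∂ρ)) := by
    refine tendsto_integral_of_dominated_convergence (fun _ => M + M) (fun k => ?_)
      (integrable_const _) (fun k => ae_of_all _ fun p => ?_) (ae_of_all _ fun p => ?_)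
    · have hθk := (hθ k).continuous
      exact (((hθk.comp continuous_snd).smul hW1).sub
        ((hθk.comp continuous_fst).smul hW0)).aestronglyMeasurable
    · exact (norm_sub_le _ _).trans (add_le_add (hθ_le _ _ _ (hM _)) (hθ_le _ _ _ (hM _)))
    · simpa using ((hθ1 p.2).smul_const (W (1, p.2))).sub ((hθ1 p.1).smul_const (W (0, p.1)))
  have hlim0 : Tendsto (fun k => ∫ p, (θ k p.2 • W (1, p.2) - θ k p.1 • W (0, p.1)) ∂ρ) atTop
      (𝓝 0) := by
    refine squeeze_zero_norm
      (fun k => norm_integral_cutoff_sub_le hJ hv hW hM htr (hθ k) (hθs k) (hθd k)) ?_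
    simpa using ((hr0.mul_const c).mul_const M).mul_const _
  have hWi1 : Integrable (fun p : E n × E n => W (1, p.2)) ρ :=
    (integrable_const M).mono' hW1.aestronglyMeasurable (ae_of_all _ fun p => hM _)
  have hWi0 : Integrable (fun p : E n × E n => W (0, p.1)) ρ :=
    (integrable_const M).mono' hW0.aestronglyMeasurable (ae_of_all _ fun p => hM _)
  have := tendsto_nhds_unique hlim hlim0
  rwa [integral_sub hWi1 hWi0, sub_eq_zero] at this

end Transport


/-! ### Consistency models of zero loss -/

lemma IsConsistencyModel.continuous_apply {n : ℕ} {f : ℝ → E n → E n} (hf : IsConsistencyModel f)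
    {t : ℝ} (ht : t ∈ Icc (0 : ℝ) 1) : Continuous (f t) :=
  hf.contDiffOn.continuousOn.comp_continuous (f := fun x => (t, x)) (by fun_prop)
    fun x => mem_cylinder ht x

/-- If a consistency model is constant along the velocity field of a coupling, then `f_0` pushes
the first marginal to the second one. -/
lemma IsConsistencyModel.map_fst_eq_snd {n : ℕ} {J : ℝ → E n → E n → E n}
    {ρ : Measure (E n × E n)} [IsProbabilityMeasure ρ] {f v : ℝ → E n → E n}
    (hf : IsConsistencyModel f) (hJ : IsInterpolant J) (hv : IsVelocityField J ρ v)
    (htr : ∀ᵐ t ∂(volume.restrict (Ioo (0 : ℝ) 1)), ∀ᵐ p ∂ρ,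
      fderivWithin ℝ (Function.uncurry f) (cylinder n) (t, J t p.1 p.2)
        (1, v t (J t p.1 p.2)) = 0) :
    ρ.fst.map (f 0) = ρ.snd := by
  have hf0 : Continuous (f 0) := hf.continuous_apply (by simp)
  have : IsProbabilityMeasure (ρ.fst.map (f 0)) :=
    Measure.isProbabilityMeasure_map hf0.aemeasurable
  refine Measure.ext_of_charFun (funext fun ξ => ?_)
  -- Characters are smooth, bounded by `1` and determine a finite measure; composing with one makes
  -- the possibly unbounded `f` a bounded test function.
  let φ : E n → ℂ := fun x => Complex.exp ((inner ℝ x ξ : ℝ) * Complex.I)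
  have hφ : ContDiff ℝ 1 φ := by
    have h1 : ContDiff ℝ 1 fun x : E n => ((inner ℝ x ξ : ℝ) : ℂ) :=
      Complex.ofRealCLM.contDiff.comp (contDiff_id.inner ℝ contDiff_const)
    exact (h1.mul contDiff_const).cexp
  have hφ1 : ∀ x, ‖φ x‖ ≤ 1 := fun x => (Complex.norm_exp_ofReal_mul_I _).le
  have hW : ContDiffOn ℝ 1 (φ ∘ Function.uncurry f) (cylinder n) :=
    hφ.comp_contDiffOn hf.contDiffOn
  have hWtr : ∀ᵐ t ∂(volume.restrict (Ioo (0 : ℝ) 1)), ∀ᵐ p ∂ρ,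
      fderivWithin ℝ (φ ∘ Function.uncurry f) (cylinder n) (t, J t p.1 p.2)
        (1, v t (J t p.1 p.2)) = 0 := by
    filter_upwards [htr, ae_restrict_mem measurableSet_Ioo] with t h0 ht
    filter_upwards [h0] with p hp
    have hmem := mem_cylinder (Ioo_subset_Icc_self ht) (J t p.1 p.2)
    rw [fderiv_comp_fderivWithin _ ((hφ.differentiable one_ne_zero) _)
      ((hf.contDiffOn.differentiableOn one_ne_zero) _ hmem) (uniqueDiffOn_cylinder n _ hmem)]
    simp [hp]
  have key := integral_end_eq_integral_start hJ hv hW (fun z => hφ1 _) hWtr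
  simp only [Function.comp_apply, Function.uncurry_apply_pair, hf.one] at key
  rw [charFun_apply, charFun_apply, integral_map hf0.aemeasurable
    hφ.continuous.aestronglyMeasurable, Measure.fst, Measure.snd,
    integral_map (f := fun x => φ (f 0 x)) measurable_fst.aemeasurable
      (hφ.continuous.comp hf0).aestronglyMeasurable,
    integral_map measurable_snd.aemeasurable hφ.continuous.aestronglyMeasurable]
  exact key.symm

/-- The normalized consistency error converges to the squared norm of the material derivative. -/
lemma IsConsistencyModel.tendsto_consistencyError_div {n : ℕ} {f : ℝ → E n → E n}
    (hf : IsConsistencyModel f) (v : ℝ → E n → E n) {t : ℝ} (ht : t ∈ Ioo (0 : ℝ) 1) (x : E n) :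
    Tendsto (fun δ : ℝ => consistencyError f v t x δ / ENNReal.ofReal (δ ^ 2)) (𝓝[>] 0)
      (𝓝 (‖fderivWithin ℝ (Function.uncurry f) (cylinder n) (t, x) (1, v t x)‖ₑ ^ 2)) := by
  have hF := hasFDerivAt_of_contDiffOn_cylinder hf.contDiffOn ht x
  have hline : HasDerivAt (fun δ : ℝ => (t + δ, x + δ • v t x)) (1, v t x) 0 := by
    refine ((hasDerivAt_id (0 : ℝ)).const_add t).prodMk ?_
    simpa using ((hasDerivAt_id (0 : ℝ)).smul_const (v t x)).const_add x
  have hc := HasFDerivAt.comp_hasDerivAt_of_eq (0 : ℝ) hF hline (by simp)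
  have hs := (hasDerivAt_iff_tendsto_slope_zero.1 hc).mono_left
    (nhdsWithin_mono 0 (fun y (hy : y ∈ Ioi (0 : ℝ)) => ne_of_gt hy))
  have he := (ENNReal.continuous_pow 2).continuousAt.tendsto.comp
    (continuous_enorm.continuousAt.tendsto.comp hs)
  refine he.congr' ?_
  filter_upwards [self_mem_nhdsWithin] with δ hδ
  have hδ : 0 < δ := hδ
  simp only [Function.comp_apply, Function.uncurry_apply_pair, zero_add, add_zero, zero_smul,
    consistencyError]
  rw [enorm_smul, enorm_inv hδ.ne', mul_pow, mul_comm, ← ENNReal.inv_pow, ← div_eq_mul_inv,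
    ENNReal.ofReal_pow hδ.le, Real.enorm_of_nonneg hδ.le, ← enorm_neg, neg_sub]

lemma IsConsistencyModel.lossGCM_eq {n : ℕ} {f : ℝ → E n → E n} (hf : IsConsistencyModel f)
    (J : ℝ → E n → E n → E n) (ρ : Measure (E n × E n)) (v : ℝ → E n → E n) :
    lossGCM J ρ f v = ∫⁻ t in Ioo (0 : ℝ) 1, ∫⁻ p : E n × E n,
      ‖fderivWithin ℝ (Function.uncurry f) (cylinder n) (t, J t p.1 p.2)
        (1, v t (J t p.1 p.2))‖ₑ ^ 2 ∂ρ :=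
  setLIntegral_congr_fun measurableSet_Ioo fun _ ht =>
    lintegral_congr fun _ => (hf.tendsto_consistencyError_div v ht _).liminf_eq

/-- A vanishing loss forces the model to be constant along the velocity field. -/
lemma IsConsistencyModel.ae_material_derivative_eq_zero {n : ℕ} {J : ℝ → E n → E n → E n}
    {ρ : Measure (E n × E n)} [SFinite ρ] {f v : ℝ → E n → E n}
    (hf : IsConsistencyModel f) (hJ : IsInterpolant J) (hv : Measurable (Function.uncurry v))
    (h0 : lossGCM J ρ f v = 0) :
    ∀ᵐ t ∂(volume.restrict (Ioo (0 : ℝ) 1)), ∀ᵐ p ∂ρ,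
      fderivWithin ℝ (Function.uncurry f) (cylinder n) (t, J t p.1 p.2)
        (1, v t (J t p.1 p.2)) = 0 := by
  -- With clamped times the integrand is measurable everywhere; it is unchanged on `(0,1)`.
  let G : ℝ × (E n × E n) → ℝ≥0∞ := fun q =>
    ‖fderivWithin ℝ (Function.uncurry f) (cylinder n) (clamp q.1, J (clamp q.1) q.2.1 q.2.2)
      (1, v (clamp q.1) (J (clamp q.1) q.2.1 q.2.2))‖ₑ ^ 2
  have hG : Measurable G := by
    have h1 := hJ.stronglyMeasurable_comp_clamp
      (continuousOn_fderivWithin_cylinder hf.contDiffOn)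
    have h2 : Measurable fun q : ℝ × (E n × E n) =>
        v (clamp q.1) (J (clamp q.1) q.2.1 q.2.2) :=
      hv.comp ((continuous_clamp.measurable.comp measurable_fst).prodMk hJ.measurable_clamp)
    have h3 : StronglyMeasurable fun q : ℝ × (E n × E n) =>
        ((1 : ℝ), v (clamp q.1) (J (clamp q.1) q.2.1 q.2.2)) :=
      (measurable_const.prodMk h2).stronglyMeasurable
    have h4 : StronglyMeasurable fun q : ℝ × (E n × E n) =>
        fderivWithin ℝ (Function.uncurry f) (cylinder n) (clamp q.1, J (clamp q.1) q.2.1 q.2.2)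
          (1, v (clamp q.1) (J (clamp q.1) q.2.1 q.2.2)) :=
      isBoundedBilinearMap_apply.continuous.comp_stronglyMeasurable (h1.prodMk h3)
    exact h4.measurable.enorm.pow_const 2
  have hloss : ∫⁻ t in Ioo (0 : ℝ) 1, ∫⁻ p, G (t, p) ∂ρ = 0 := by
    rw [← h0, hf.lossGCM_eq]
    refine setLIntegral_congr_fun measurableSet_Ioo fun t ht => ?_
    simp only [G, clamp_of_mem (Ioo_subset_Icc_self ht)]
  rw [lintegral_eq_zero_iff hG.lintegral_prod_right'] at hloss
  filter_upwards [hloss, ae_restrict_mem measurableSet_Ioo] with t h1 ht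
  have h2 := (lintegral_eq_zero_iff (hG.comp measurable_prodMk_left)).1 h1
  filter_upwards [h2] with p hp
  simpa [G, clamp_of_mem (Ioo_subset_Icc_self ht)] using hp

/-! ### The consistency model of a flow -/

/-- A flow yields the consistency model `f_t = ψ_1 ∘ ψ_t⁻¹`, which is constant along the velocity
field. -/
lemma IsFlow.exists_isConsistencyModel {n : ℕ} {v ψ : ℝ → E n → E n} (hψ : IsFlow v ψ) :
    ∃ (f : ℝ → E n → E n) (χ : E n → E n), IsConsistencyModel f ∧ Continuous χ ∧
      Function.LeftInverse χ (f 0) ∧ Function.RightInverse χ (f 0) ∧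
      ∀ t ∈ Ioo (0 : ℝ) 1, ∀ x,
        fderivWithin ℝ (Function.uncurry f) (cylinder n) (t, x) (1, v t x) = 0 := by
  obtain ⟨χ, hχ, hinv⟩ := hψ.inverse
  have h1 : (1 : ℝ) ∈ Icc (0 : ℝ) 1 := by simp
  have h0 : (0 : ℝ) ∈ Icc (0 : ℝ) 1 := by simp
  have hχ0 : ∀ x, χ 0 x = x := fun x => by simpa [hψ.zero] using (hinv 0 h0).1 x
  have hψ1 : ContDiff ℝ 1 (ψ 1) := by
    rw [← contDiffOn_univ]
    exact hψ.contDiffOn.comp (f := fun x : E n => ((1 : ℝ), x)) (by fun_prop)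
      fun x _ => mem_cylinder h1 x
  have hf : IsConsistencyModel fun t x => ψ 1 (χ t x) :=
    ⟨hψ1.comp_contDiffOn hχ, fun x => (hinv 1 h1).2 x⟩
  refine ⟨_, χ 1, hf, ?_, fun x => ?_, fun x => ?_, fun t ht x => ?_⟩
  · exact hχ.continuousOn.comp_continuous (f := fun x => ((1 : ℝ), x)) (by fun_prop)
      fun x => mem_cylinder h1 x
  · simpa [hχ0] using (hinv 1 h1).1 x
  · simpa [hχ0] using (hinv 1 h1).2 x
  -- Along the trajectory of `y` the model has the constant value `ψ 1 y`; by the chain rule its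
  -- time derivative there is the material derivative.
  · obtain ⟨y, rfl⟩ : ∃ y, ψ t y = x := ⟨χ t x, (hinv t (Ioo_subset_Icc_self ht)).2 x⟩
    have hd := (hasFDerivAt_of_contDiffOn_cylinder hf.contDiffOn ht (ψ t y)).comp_hasDerivAt t
      ((hasDerivAt_id t).prodMk (hψ.hasDerivAt y t ht))
    have hconst : HasDerivAt ((Function.uncurry fun t x => ψ 1 (χ t x)) ∘ fun s => (id s, ψ s y))
        0 t := by
      refine (hasDerivAt_const t (ψ 1 y)).congr_of_eventuallyEq ?_
      filter_upwards [Icc_mem_nhds ht.1 ht.2] with s hs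
      simp [(hinv s hs).1 y]
    exact hd.unique hconst

end FlowMatching

/-! ### Comparison with the flow competitor -/

theorem mainTheorem1 {d n : ℕ}
    (ρ₀ : Measure (E d)) [IsProbabilityMeasure ρ₀] (ρ₁ : Measure (E n)) [IsProbabilityMeasure ρ₁]
    (div : Measure (E n) → Measure (E n) → ℝ≥0∞) (hdiv : IsDivergence div)
    (J : ℝ → E n → E n → E n) (hJ : IsInterpolant J)
    (𝒞 : Set (Measure (E n × E n))) (𝒢 : Set (E d → E n))
    (hflow : ∃ ρ ∈ 𝒞, ρ.snd = ρ₁ ∧ ∃ v ψ, IsVelocityField J ρ v ∧ IsFlow v ψ)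
    (gstar : E d → E n) (hgstar : gstar ∈ 𝒢) (hgstar_meas : AEMeasurable gstar ρ₀)
    (hgstar_div : div (ρ₀.map gstar) ρ₁ = 0)
    (g h : E d → E n) (f : ℝ → E n → E n) (hsol : IsGCMSolution ρ₀ ρ₁ J 𝒞 𝒢 g h f) :
    IsMatchingSolution div ρ₀ ρ₁ 𝒢 g ∧ ρ₀.map g = ρ₁ := by
  have hprob : ∀ ρ : Measure (E n × E n), ρ.snd = ρ₁ → IsProbabilityMeasure ρ := fun ρ hρ =>
    ⟨by rw [← Measure.snd_univ, hρ, measure_univ]⟩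
  have hstar : ρ₀.map gstar = ρ₁ :=
    (hdiv _ _ (Measure.isProbabilityMeasure_map hgstar_meas) inferInstance).1 hgstar_div
  obtain ⟨ρ, v, hfeas, hmin⟩ := hsol
  have hloss : lossGCM J ρ f v = 0 := by
    obtain ⟨ρ', hρ'𝒞, hρ', v', ψ, hv', hψ⟩ := hflow
    have := hprob ρ' hρ'
    obtain ⟨f', χ, hf', hχ, hl, hr, hmat⟩ := hψ.exists_isConsistencyModel
    have hpush : ρ'.fst.map (f' 0) = ρ₁ := by
      rw [← hρ']
      refine hf'.map_fst_eq_snd hJ hv' ?_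
      filter_upwards [ae_restrict_mem measurableSet_Ioo] with t ht
      exact ae_of_all _ fun p => hmat t ht _
    have hcomp : f' 0 ∘ (χ ∘ gstar) = gstar := funext fun x => hr (gstar x)
    -- Both sides equal `χ_# ρ₁`, since `χ` inverts `f' 0`.
    have hfst : ρ'.fst = ρ₀.map (χ ∘ gstar) := by
      rw [← AEMeasurable.map_map_of_aemeasurable hχ.aemeasurable hgstar_meas, hstar, ← hpush,
        Measure.map_map hχ.measurable (hf'.continuous_apply (by simp)).measurable,
        hl.comp_eq_id, Measure.map_id]
    have hle := hmin gstar (χ ∘ gstar) f' ρ' v'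
      { aemeasurable := hχ.measurable.comp_aemeasurable hgstar_meas
        model := hf'
        mem := by rwa [hcomp]
        eq_comp := hcomp.symm
        admissible := hρ'𝒞
        coupling := ⟨hfst, hρ'⟩
        velocity := hv' }
    have hzero : lossGCM J ρ' f' v' = 0 := by
      rw [hf'.lossGCM_eq]
      refine (setLIntegral_congr_fun measurableSet_Ioo fun t ht => ?_).trans lintegral_zero
      simp [hmat t ht]
    exact le_antisymm (hle.trans_eq hzero) bot_le
  have := hprob ρ hfeas.coupling.2
  have hf0 : Measurable (f 0) := (hfeas.model.continuous_apply (by simp)).measurable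
  have hg : AEMeasurable g ρ₀ := by
    rw [hfeas.eq_comp]
    exact hf0.comp_aemeasurable hfeas.aemeasurable
  have hmap : ρ₀.map g = ρ₁ := by
    rw [hfeas.eq_comp, ← AEMeasurable.map_map_of_aemeasurable hf0.aemeasurable hfeas.aemeasurable,
      ← hfeas.coupling.1, ← hfeas.coupling.2]
    exact hfeas.model.map_fst_eq_snd hJ hfeas.velocity
      (hfeas.model.ae_material_derivative_eq_zero hJ hfeas.velocity.measurable hloss)
  refine ⟨⟨?_, hg, fun g' _ _ => ?_⟩, hmap⟩
  · rw [hfeas.eq_comp]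
    exact hfeas.mem
  · rw [hmap, (hdiv ρ₁ ρ₁ inferInstance inferInstance).2 rfl]
    exact bot_le
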